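/- Let $X$ be a (possibly infinite, loopless) connected non-bipartite graph with vertex set $V(X)$, and let $\mathcal N(X)$ be its neighborhood complex, that is, the simplicial complex whose faces are the nonempty finite sets $W\subseteq V(X)$ all of whose elements have a common neighbor in $X$. Let $|\mathcal N(X)|$ be the geometric realization of $\mathcal N(X)$ with the weak topology (a set is open if and only if its intersection with every closed simplex is open in that simplex), and let $x_0\in|\mathcal N(X)|$. If every element of the topological fundamental group $\pi_1(|\mathcal N(X)|,x_0)$ has finite order, then the chromatic number of $X$ satisfies $\chi(X)\geq 4$ (where $\chi(X)=\infty$ if $X$ has no proper coloring with finitely many colors). -/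

import Mathlib

namespace SimpleGraph

/-- The neighborhood complex of a graph: its faces are the nonempty finite sets of vertices that
have a common neighbor. -/
def neighborhoodComplex {V : Type*} (X : SimpleGraph V) : PreAbstractSimplicialComplex V where
  faces := {s | s.Nonempty ∧ ∃ w, ∀ v ∈ s, X.Adj v w}
  isRelLowerSet_faces := fun _ hs =>
    ⟨hs.1, fun _ hts ht => ⟨ht, hs.2.imp fun _ hw v hv => hw v (hts hv)⟩⟩

end SimpleGraph

namespace PreAbstractSimplicialComplex

/-- The points of the geometric realization of an abstract simplicial complex, in barycentric
coordinates: nonnegative weights on the vertices, vanishing outside some face and summing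
to `1` over that face. -/
@[ext]
structure Realization {V : Type*} (K : PreAbstractSimplicialComplex V) where
  weight : V → ℝ
  nonneg : ∀ v, 0 ≤ weight v
  exists_face : ∃ s ∈ K.faces, (∀ v, v ∉ s → weight v = 0) ∧ ∑ v ∈ s, weight v = 1

namespace Realization

open Classical in
/-- The standard simplex spanned by a face `s`, mapped into the realization through extension of
the barycentric coordinates by zero. -/
noncomputable def ofSimplex {V : Type*} (K : PreAbstractSimplicialComplex V) (s : Finset V)
    (hs : s ∈ K.faces) (p : stdSimplex ℝ s) : K.Realization where
  weight v := if h : v ∈ s then p.1 ⟨v, h⟩ else 0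
  nonneg v := by
    split_ifs with h
    · exact p.2.1 _
    · exact le_rfl
  exists_face := by
    refine ⟨s, hs, fun v hv => dif_neg hv, ?_⟩
    rw [← Finset.sum_coe_sort, ← p.2.2]
    exact Finset.sum_congr rfl fun v _ => dif_pos v.2

/-- The weak (coherent) topology on the realization: a set is open if and only if its preimage
in the standard simplex of every face is open. -/
noncomputable instance {V : Type*} (K : PreAbstractSimplicialComplex V) : TopologicalSpace K.Realization :=
  ⨆ s : {s : Finset V // s ∈ K.faces},
    TopologicalSpace.coinduced (ofSimplex K s.1 s.2) inferInstance

end Realization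

end PreAbstractSimplicialComplex

/-! Suppose `X` has a 3-colouring. Send each vertex to the cube root of unity of its colour and
extend affinely over the simplices. A face has a common neighbour `w`, so its colours avoid that of
`w` and its roots lie in an open half-plane: the extension misses `0`. Moving two steps along a walk
stays in a simplex of the complex, so an odd closed walk run twice gives a loop. It changes the
logarithm of the map by a nonzero multiple of an odd sum of signs. Such changes are additive and
homotopy invariant, so the loop has infinite order. -/

open scoped unitInterval

/-- A homotopy class of paths has increment `d` of the logarithm of `f` if, along one of its
representatives, a continuous branch of `log f` increases by `d`. -/
def HasLogIncrement {Y : Type*} [TopologicalSpace Y] (f : Y → ℂ) {x y : Y}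
    (γ : Path.Homotopic.Quotient x y) (d : ℂ) : Prop :=
  ∃ (p : Path x y) (a b : ℂ) (Γ : Path a b), Path.Homotopic.Quotient.mk p = γ ∧
    (∀ t, Complex.exp (Γ t) = f (p t)) ∧ b - a = d

/-! ### Logarithmic increments of path classes -/

namespace HasLogIncrement

variable {Y : Type*} [TopologicalSpace Y] {f : Y → ℂ} {x y z : Y}

theorem refl (hx : f x ≠ 0) : HasLogIncrement f (Path.Homotopic.Quotient.refl x) 0 :=
  ⟨Path.refl x, Complex.log (f x), Complex.log (f x), Path.refl _, rfl,
    fun _ => Complex.exp_log hx, sub_self _⟩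

theorem trans {γ : Path.Homotopic.Quotient x y} {γ' : Path.Homotopic.Quotient y z} {d d' : ℂ}
    (h : HasLogIncrement f γ d) (h' : HasLogIncrement f γ' d') :
    HasLogIncrement f (γ.trans γ') (d + d') := by
  obtain ⟨p, a, b, Γ, rfl, hΓ, rfl⟩ := h
  obtain ⟨p', a', b', Γ', rfl, hΓ', rfl⟩ := h'
  have hb : Complex.exp (b - a') = 1 := by
    have h1 := hΓ 1
    have h0 := hΓ' 0
    rw [Γ.target, p.target] at h1
    rw [Γ'.source, p'.source] at h0
    rw [Complex.exp_sub, h1, ← h0, div_self (Complex.exp_ne_zero _)]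
  -- `b` and `a'` are logarithms of the same number, so this shift is by a period of `exp`.
  let Γ'' : Path b (b' + (b - a')) :=
    (Γ'.map (f := fun w => w + (b - a')) (by fun_prop)).cast (by ring) rfl
  refine ⟨p.trans p', a, b' + (b - a'), Γ.trans Γ'', Path.Homotopic.Quotient.mk_trans p p',
    fun t => ?_, by ring⟩
  rw [Path.trans_apply, Path.trans_apply]
  split_ifs
  · exact hΓ _
  · simp only [Γ'', Path.cast_coe, Path.map_coe, Function.comp_apply, Complex.exp_add, hb, hΓ',
      mul_one]

/-- Homotopic paths lifted through the covering `exp` of the punctured plane from one starting point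
end at the same point. -/
theorem unique (hf : Continuous f) (hf0 : ∀ y, f y ≠ 0) {γ : Path.Homotopic.Quotient x y}
    {d d' : ℂ} (h : HasLogIncrement f γ d) (h' : HasLogIncrement f γ d') : d = d' := by
  obtain ⟨p, a, b, Γ, rfl, hΓ, rfl⟩ := h
  obtain ⟨p', a', b', Γ', hp, hΓ', rfl⟩ := h'
  let g : C(Y, {z : ℂ // z ≠ 0}) := ⟨fun y => ⟨f y, hf0 y⟩, by fun_prop⟩
  have cov := Complex.isCoveringMap_exp
  have hpp : (g.comp (p' : C(I, Y))).HomotopicRel (g.comp (p : C(I, Y))) {0, 1} :=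
    (Path.Homotopic.Quotient.exact hp).elim fun H => ⟨H.compContinuousMap g⟩
  have ha : Complex.exp a = f x := by simpa using hΓ 0
  have ha' : Complex.exp a' = f x := by simpa using hΓ' 0
  have haa : Complex.exp (a - a') = 1 := by
    rw [Complex.exp_sub, ha, ha', div_self (hf0 x)]
  have h0 : g.comp (p : C(I, Y)) 0 = ⟨Complex.exp a, a.exp_ne_zero⟩ :=
    Subtype.ext (by simp [g, ha])
  have h0' : g.comp (p' : C(I, Y)) 0 = ⟨Complex.exp a, a.exp_ne_zero⟩ :=
    Subtype.ext (by simp [g, ha])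
  have e1 : (Γ : C(I, ℂ)) = cov.liftPath _ a h0 :=
    (cov.eq_liftPath_iff' h0).2 ⟨funext fun t => Subtype.ext (hΓ t), Γ.source⟩
  let Δ : C(I, ℂ) := ⟨fun t => Γ' t + (a - a'), by fun_prop⟩
  have e2 : Δ = cov.liftPath _ a h0' :=
    (cov.eq_liftPath_iff' h0').2 ⟨funext fun t => Subtype.ext (by
      simp [Δ, g, Complex.exp_add, haa, hΓ']), by simp [Δ]⟩
  have key := cov.liftPath_apply_one_eq_of_homotopicRel hpp a h0' h0
  rw [← e1, ← e2] at key
  have : b' + (a - a') = b := by simpa [Δ] using key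
  rw [← this]; ring

theorem pow {γ : FundamentalGroup Y x} {d : ℂ} (hx : f x ≠ 0)
    (h : HasLogIncrement f γ.toPath d) (n : ℕ) :
    HasLogIncrement f (γ ^ n).toPath (n * d) := by
  induction n with
  | zero => rw [Nat.cast_zero, zero_mul]; exact refl hx
  | succ n ih =>
    rw [pow_succ', Nat.cast_succ, add_mul, one_mul]
    -- The product in `FundamentalGroup` traverses its right factor first.
    exact ih.trans h

theorem not_isOfFinOrder (hf : Continuous f) (hf0 : ∀ y, f y ≠ 0) {γ : FundamentalGroup Y x}
    {d : ℂ} (h : HasLogIncrement f γ.toPath d) (hd : d ≠ 0) : ¬ IsOfFinOrder γ := by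
  rw [isOfFinOrder_iff_pow_eq_one]
  rintro ⟨n, hn, hγ⟩
  have h1 := h.pow (hf0 x) n
  rw [hγ] at h1
  have h2 := h1.unique hf hf0 (refl (hf0 x))
  exact mul_ne_zero (Nat.cast_ne_zero.2 hn.ne') hd h2

end HasLogIncrement

/-! ### Affine maps from the realization to the plane -/

namespace PreAbstractSimplicialComplex.Realization

variable {V : Type*} {K : PreAbstractSimplicialComplex V}

theorem continuous_ofSimplex {s : Finset V} (hs : s ∈ K.faces) : Continuous (ofSimplex K s hs) :=
  continuous_iff_coinduced_le.2
    (le_iSup (fun s : {s : Finset V // s ∈ K.faces} =>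
      TopologicalSpace.coinduced (ofSimplex K s.1 s.2) inferInstance) ⟨s, hs⟩)

theorem continuous_of_comp_ofSimplex {Z : Type*} [TopologicalSpace Z] {f : K.Realization → Z}
    (h : ∀ (s : Finset V) (hs : s ∈ K.faces), Continuous (f ∘ ofSimplex K s hs)) :
    Continuous f :=
  continuous_iSup_dom.2 fun s => continuous_coinduced_dom.2 (h s.1 s.2)

theorem exists_eq_ofSimplex (x : K.Realization) :
    ∃ (s : Finset V) (hs : s ∈ K.faces) (p : stdSimplex ℝ s), x = ofSimplex K s hs p := by
  obtain ⟨s, hs, hx, h1⟩ := x.exists_face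
  refine ⟨s, hs, ⟨fun v => x.weight v, fun v => x.nonneg v, ?_⟩, ?_⟩
  · rw [Finset.sum_coe_sort s x.weight, h1]
  · ext v
    by_cases hv : v ∈ s
    · simp [ofSimplex, hv]
    · simp [ofSimplex, hv, hx]

open Classical in
/-- The point of the realization given by a vertex of the complex. -/
noncomputable def vertex (K : PreAbstractSimplicialComplex V) (v : V) (hv : {v} ∈ K.faces) :
    K.Realization where
  weight := Pi.single v 1
  nonneg w := by
    rw [Pi.single_apply]
    split_ifs <;> norm_num
  exists_face := ⟨{v}, hv, fun w hw => Pi.single_eq_of_ne (by simpa using hw) _, by simp⟩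

open Classical in
theorem ofSimplex_vertex {s : Finset V} (hs : s ∈ K.faces) (v : s) (hv : {v.1} ∈ K.faces) :
    ofSimplex K s hs ⟨Pi.single v 1, single_mem_stdSimplex ℝ v⟩ = vertex K v hv := by
  ext w
  by_cases hw : w ∈ s
  · simp [ofSimplex, vertex, hw, Pi.single_apply, Subtype.ext_iff]
  · have : w ≠ v := fun h => hw (h ▸ v.2)
    simp [ofSimplex, vertex, hw, this]

/-- The affine extension of a function on the vertices to the realization. -/
noncomputable def extend (K : PreAbstractSimplicialComplex V) (z : V → ℂ)
    (x : K.Realization) : ℂ :=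
  ∑ᶠ v, (x.weight v : ℂ) * z v

variable (z : V → ℂ)

theorem extend_ofSimplex {s : Finset V} (hs : s ∈ K.faces) (p : stdSimplex ℝ s) :
    extend K z (ofSimplex K s hs p) = ∑ v : s, (p.1 v : ℂ) * z v := by
  rw [extend, finsum_eq_sum_of_support_subset (s := s), ← Finset.sum_coe_sort]
  · simp [ofSimplex]
  · intro v hv
    by_contra h
    have h' : v ∉ s := h
    simp [ofSimplex, h'] at hv

theorem continuous_extend : Continuous (extend K z) := by
  refine continuous_of_comp_ofSimplex fun s hs => ?_
  have : extend K z ∘ ofSimplex K s hs = fun p => ∑ v : s, (p.1 v : ℂ) * z v :=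
    funext fun p => extend_ofSimplex z hs p
  rw [this]
  refine continuous_finsetSum _ fun v _ => (Complex.continuous_ofReal.comp ?_).mul continuous_const
  exact (continuous_apply v).comp continuous_subtype_val

theorem extend_vertex (v : V) (hv : {v} ∈ K.faces) : extend K z (vertex K v hv) = z v := by
  classical
  rw [← ofSimplex_vertex hv ⟨v, Finset.mem_singleton_self v⟩ hv, extend_ofSimplex,
    Fintype.sum_eq_single ⟨v, Finset.mem_singleton_self v⟩]
  · simp
  · intro w hw
    simp [hw]

/-- An open half-plane bounded by a line through `0` is convex. -/
theorem re_extend_mul_pos {s : Finset V} (hs : s ∈ K.faces) {a : ℂ}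
    (ha : ∀ v ∈ s, 0 < (z v * a).re) (p : stdSimplex ℝ s) :
    0 < (extend K z (ofSimplex K s hs p) * a).re := by
  rw [extend_ofSimplex, Finset.sum_mul, Complex.re_sum]
  have hnn : ∀ v : s, 0 ≤ p.1 v := p.2.1
  have hre : ∀ v : s, ((p.1 v : ℂ) * z v * a).re = p.1 v * (z v * a).re := fun v => by
    rw [mul_assoc, Complex.re_ofReal_mul]
  simp only [hre]
  refine Finset.sum_pos' (fun v _ => mul_nonneg (hnn v) (ha v v.2).le) ?_
  by_contra! hcon
  have h0 : ∀ v : s, p.1 v = 0 := fun v =>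
    le_antisymm (by
      by_contra! hv
      exact absurd (mul_pos hv (ha v v.2)) (hcon v (Finset.mem_univ v)).not_gt) (hnn v)
  have := p.2.2
  simp [h0] at this

/-- Two points of a common simplex on which `extend K z * a` has positive real part are joined by
a path along which the logarithm of `extend K z` is controlled by the principal branch. -/
theorem exists_hasLogIncrement_ofSimplex {s : Finset V} (hs : s ∈ K.faces) {a : ℂ}
    (ha : ∀ v ∈ s, 0 < (z v * a).re) (p q : stdSimplex ℝ s) :
    ∃ γ : Path.Homotopic.Quotient (ofSimplex K s hs p) (ofSimplex K s hs q),
      HasLogIncrement (extend K z) γ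
        (Complex.log (extend K z (ofSimplex K s hs q) * a) -
          Complex.log (extend K z (ofSimplex K s hs p) * a)) := by
  have : PathConnectedSpace (stdSimplex ℝ s) :=
    isPathConnected_iff_pathConnectedSpace.1
      ((convex_stdSimplex ℝ s).isPathConnected ⟨p.1, p.2⟩)
  let π := PathConnectedSpace.somePath p q
  let P := π.map (continuous_ofSimplex hs)
  have hpos (t) : 0 < (extend K z (P t) * a).re := re_extend_mul_pos z hs ha (π t)
  have ha0 : a ≠ 0 := by
    rintro rfl
    simpa using hpos 0
  let Γ : Path (Complex.log (extend K z (P 0) * a) - Complex.log a)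
      (Complex.log (extend K z (P 1) * a) - Complex.log a) :=
    { toFun := fun t => Complex.log (extend K z (P t) * a) - Complex.log a
      continuous_toFun := by
        refine Continuous.sub (Continuous.clog ?_ fun t => Or.inl (hpos t)) continuous_const
        exact ((continuous_extend z).comp P.continuous).mul continuous_const
      source' := rfl
      target' := rfl }
  refine ⟨.mk P, P, _, _, Γ, rfl, fun t => ?_, ?_⟩
  · have hne : extend K z (P t) * a ≠ 0 := fun h => by
      simpa [h] using hpos t
    change Complex.exp (Complex.log (extend K z (P t) * a) - Complex.log a) = _
    rw [Complex.exp_sub, Complex.exp_log hne, Complex.exp_log ha0, mul_div_cancel_right₀ _ ha0]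
  · rw [P.source, P.target]
    ring

end PreAbstractSimplicialComplex.Realization

/-! ### Three colours as cube roots of unity -/

/-- The sign of the rotation from the colour `j` to the colour `i` on a cycle of three colours. -/
def rotationSign (i j : Fin 3) : ℤ := if i = j + 1 then 1 else -1

theorem odd_rotationSign (i j : Fin 3) : Odd (rotationSign i j) := by
  unfold rotationSign
  split_ifs <;> decide

theorem rotationSign_swap {i j : Fin 3} (h : i ≠ j) : rotationSign j i = -rotationSign i j := by
  revert i j
  decide

/-- The cube root of unity attached to a colour. -/
noncomputable def colorRoot (i : Fin 3) : ℂ :=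
  Complex.exp (2 * Real.pi * Complex.I / 3 * (i.1 : ℂ))

theorem colorRoot_mul_neg_inv {i j : Fin 3} (h : i ≠ j) :
    colorRoot i * -(colorRoot j)⁻¹ =
      Complex.exp ((-(Real.pi / 3 * rotationSign i j) : ℝ) * Complex.I) := by
  -- Angles in units of `π / 3`: a colour `i` sits at `2 * i`, the factor `-1` is `3`, and a full
  -- turn is `6`.
  have key : ∃ ε : ℤ,
      2 * (i.1 : ℤ) - 2 * (j.1 : ℤ) + rotationSign i j = 3 + 6 * ε := by
    have : 2 * (i.1 : ℤ) - 2 * (j.1 : ℤ) + rotationSign i j = 3 ∨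
        2 * (i.1 : ℤ) - 2 * (j.1 : ℤ) + rotationSign i j = -3 := by
      revert i j
      decide
    rcases this with h | h
    · exact ⟨0, by rw [h]; norm_num⟩
    · exact ⟨-1, by rw [h]; norm_num⟩
  obtain ⟨ε, hε⟩ := key
  have hε' : (2 * (i.1 : ℂ) - 2 * (j.1 : ℂ) + rotationSign i j : ℂ) = 3 + 6 * ε := by
    exact_mod_cast hε
  rw [colorRoot, colorRoot, ← Complex.exp_neg, mul_neg, ← Complex.exp_add, ← neg_one_mul,
    ← Complex.exp_pi_mul_I, ← Complex.exp_add, Complex.exp_eq_exp_iff_exists_int]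
  refine ⟨ε + 1, ?_⟩
  push_cast
  linear_combination (Real.pi * Complex.I / 3) * hε'

theorem re_colorRoot_mul_neg_inv_pos {i j : Fin 3} (h : i ≠ j) :
    0 < (colorRoot i * -(colorRoot j)⁻¹).re := by
  rw [colorRoot_mul_neg_inv h, Complex.exp_ofReal_mul_I_re, Real.cos_neg]
  rcases (show rotationSign i j = 1 ∨ rotationSign i j = -1 by
    unfold rotationSign; split_ifs <;> simp) with h | h <;> simp [h]

theorem log_colorRoot_mul_neg_inv {i j : Fin 3} (h : i ≠ j) :
    Complex.log (colorRoot i * -(colorRoot j)⁻¹) =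
      -(Real.pi / 3 * rotationSign i j) * Complex.I := by
  rw [colorRoot_mul_neg_inv h]
  have hpi := Real.pi_pos
  rw [Complex.log_exp]
  · push_cast; ring
  all_goals
    rcases (show rotationSign i j = 1 ∨ rotationSign i j = -1 by
      unfold rotationSign; split_ifs <;> simp) with h | h <;> simp [h] <;> linarith

/-! ### From odd closed walks to loops of infinite order -/

namespace SimpleGraph

open PreAbstractSimplicialComplex Realization

variable {V : Type*} {X : SimpleGraph V}

/-- The total rotation of a colouring with three colours along a walk. -/
def Walk.rotation (c : V → Fin 3) : ∀ {u v : V}, X.Walk u v → ℤ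
  | _, _, .nil => 0
  | u, _, .cons (v := w) _ p => rotationSign (c w) (c u) + p.rotation c

theorem Walk.rotation_append (c : V → Fin 3) {u v w : V} (p : X.Walk u v) (q : X.Walk v w) :
    (p.append q).rotation c = p.rotation c + q.rotation c := by
  induction p with
  | nil => simp [rotation]
  | cons h p ih => simp [rotation, ih, add_assoc]

theorem Walk.odd_rotation_iff (c : V → Fin 3) {u v : V} (p : X.Walk u v) :
    Odd (p.rotation c) ↔ Odd p.length := by
  induction p with
  | nil => simp [rotation]
  | cons h p ih =>
    rw [rotation, Walk.length_cons, Int.odd_add, Nat.odd_add_one, ← ih, Int.not_odd_iff_even]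
    exact iff_true_left (odd_rotationSign _ _)

theorem Connected.exists_odd_closed_walk (hconn : X.Connected) (hbip : ¬ X.IsBipartite) (v : V) :
    ∃ p : X.Walk v v, Odd p.length := by
  have h := mt two_colorable_iff_forall_loop_even.2 hbip
  push Not at h
  obtain ⟨u, p, hp⟩ := h
  obtain ⟨q⟩ := hconn.preconnected v u
  -- Going out and back along `q` adds an even length.
  refine ⟨q.append (p.append q.reverse), ?_⟩
  simp only [Walk.length_append, Walk.length_reverse]
  grind

theorem singleton_mem_faces_neighborhoodComplex {v w : V} (h : X.Adj v w) :
    {v} ∈ X.neighborhoodComplex.faces :=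
  ⟨Finset.singleton_nonempty v, w, by simpa using h⟩

theorem Coloring.re_colorRoot_pos (c : X.Coloring (Fin 3)) {s : Finset V} {w : V}
    (hw : ∀ v ∈ s, X.Adj v w) : ∀ v ∈ s, 0 < (colorRoot (c v) * -(colorRoot (c w))⁻¹).re :=
  fun v hv => re_colorRoot_mul_neg_inv_pos (c.valid (hw v hv))

/-- The map from the realization of the neighborhood complex to the punctured plane induced by a
colouring with three colours. -/
noncomputable def Coloring.toPlane (c : X.Coloring (Fin 3)) :
    X.neighborhoodComplex.Realization → ℂ :=
  extend X.neighborhoodComplex fun v => colorRoot (c v)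

theorem Coloring.toPlane_ne_zero (c : X.Coloring (Fin 3)) (x : X.neighborhoodComplex.Realization) :
    c.toPlane x ≠ 0 := by
  obtain ⟨s, hs, p, rfl⟩ := x.exists_eq_ofSimplex
  obtain ⟨w, hw⟩ := hs.2
  intro h
  have := re_extend_mul_pos _ hs (c.re_colorRoot_pos hw) p
  rw [Coloring.toPlane] at h
  simp [h] at this

theorem Coloring.exists_hasLogIncrement_of_common_neighbor (c : X.Coloring (Fin 3)) {u v w : V}
    (hu : X.Adj u w) (hv : X.Adj v w) :
    ∃ γ : Path.Homotopic.Quotient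
      (vertex X.neighborhoodComplex u (singleton_mem_faces_neighborhoodComplex hu))
      (vertex X.neighborhoodComplex v (singleton_mem_faces_neighborhoodComplex hv)),
      HasLogIncrement c.toPlane γ (-(Real.pi / 3) * Complex.I *
        ((rotationSign (c w) (c u) + rotationSign (c v) (c w) : ℤ) : ℂ)) := by
  classical
  have hw : ∀ a ∈ ({u, v} : Finset V), X.Adj a w := by simp [hu, hv]
  have hs : ({u, v} : Finset V) ∈ X.neighborhoodComplex.faces := ⟨by simp, w, hw⟩
  have := exists_hasLogIncrement_ofSimplex (fun v => colorRoot (c v)) hs (c.re_colorRoot_pos hw)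
    ⟨Pi.single ⟨u, by simp⟩ 1, single_mem_stdSimplex ℝ _⟩
    ⟨Pi.single ⟨v, by simp⟩ 1, single_mem_stdSimplex ℝ _⟩
  rw [ofSimplex_vertex hs ⟨u, _⟩ (singleton_mem_faces_neighborhoodComplex hu),
    ofSimplex_vertex hs ⟨v, _⟩ (singleton_mem_faces_neighborhoodComplex hv),
    extend_vertex, extend_vertex, log_colorRoot_mul_neg_inv (c.valid hu),
    log_colorRoot_mul_neg_inv (c.valid hv)] at this
  convert! this using 3
  -- The logarithm at `u` is subtracted; reversing the step between `u` and `w` absorbs that sign.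
  rw [rotationSign_swap (c.valid hu)]
  push_cast
  ring

theorem Coloring.exists_hasLogIncrement_of_walk (c : X.Coloring (Fin 3)) :
    ∀ {u v : V} (p : X.Walk u v), Even p.length →
      ∀ (hu : {u} ∈ X.neighborhoodComplex.faces) (hv : {v} ∈ X.neighborhoodComplex.faces),
      ∃ γ : Path.Homotopic.Quotient (vertex X.neighborhoodComplex u hu)
        (vertex X.neighborhoodComplex v hv),
        HasLogIncrement c.toPlane γ (-(Real.pi / 3) * Complex.I * (p.rotation c : ℂ))
  | _, _, .nil, _, _, _ => ⟨.refl _, by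
      simpa [Walk.rotation] using HasLogIncrement.refl (c.toPlane_ne_zero _)⟩
  | _, _, .cons _ .nil, h, _, _ => by simp at h
  | _, _, .cons h (.cons h' p), hp, _, hv => by
    have hp' : Even p.length := by
      simp only [Walk.length_cons] at hp
      grind
    obtain ⟨γ, hγ⟩ := c.exists_hasLogIncrement_of_common_neighbor h h'.symm
    obtain ⟨γ', hγ'⟩ := c.exists_hasLogIncrement_of_walk p hp'
      (singleton_mem_faces_neighborhoodComplex h'.symm) hv
    refine ⟨γ.trans γ', ?_⟩
    convert hγ.trans hγ' using 1
    simp only [Walk.rotation]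
    push_cast
    ring

theorem Coloring.exists_not_isOfFinOrder (c : X.Coloring (Fin 3)) (hconn : X.Connected)
    (hbip : ¬ X.IsBipartite) (x₀ : X.neighborhoodComplex.Realization) :
    ∃ g : FundamentalGroup X.neighborhoodComplex.Realization x₀, ¬ IsOfFinOrder g := by
  classical
  obtain ⟨s, hs, q, rfl⟩ := x₀.exists_eq_ofSimplex
  obtain ⟨⟨v, hv⟩, w, hw⟩ := id hs
  have hvf := singleton_mem_faces_neighborhoodComplex (hw v hv)
  obtain ⟨p, hp⟩ := hconn.exists_odd_closed_walk hbip v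
  -- Doubling makes the length even, while the rotation becomes twice an odd number.
  obtain ⟨γ, hγ⟩ := c.exists_hasLogIncrement_of_walk (p.append p)
    (by simp [Walk.length_append]) hvf hvf
  let e : stdSimplex ℝ s := ⟨Pi.single ⟨v, hv⟩ 1, single_mem_stdSimplex ℝ _⟩
  have he : ofSimplex _ s hs e = vertex X.neighborhoodComplex v hvf :=
    ofSimplex_vertex hs ⟨v, hv⟩ hvf
  obtain ⟨α, hα⟩ := exists_hasLogIncrement_ofSimplex (fun v => colorRoot (c v)) hs
    (c.re_colorRoot_pos hw) q e
  obtain ⟨β, hβ⟩ := exists_hasLogIncrement_ofSimplex (fun v => colorRoot (c v)) hs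
    (c.re_colorRoot_pos hw) e q
  have hodd : Odd (p.rotation c) := (p.odd_rotation_iff c).2 hp
  have hne : (p.rotation c : ℂ) ≠ 0 := by
    intro h
    rw [Int.cast_eq_zero.1 h] at hodd
    exact absurd hodd (by decide)
  -- With a variable endpoint, `he` can be substituted into the types of the path classes.
  generalize vertex X.neighborhoodComplex v hvf = y at he γ hγ
  subst he
  -- The increments of `α` and `β` are opposite, so only that of `γ` remains.
  refine ⟨FundamentalGroup.fromPath ((α.trans γ).trans β), HasLogIncrement.not_isOfFinOrder
    (continuous_extend _) c.toPlane_ne_zero ((hα.trans hγ).trans hβ) ?_⟩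
  have hd : -(Real.pi / 3) * Complex.I * ((p.rotation c : ℂ) * 2) ≠ 0 := by
    simp [hne, Real.pi_ne_zero]
  convert! hd using 1
  rw [Walk.rotation_append]
  push_cast
  ring

end SimpleGraph

theorem corollary1p5 {V : Type*} (X : SimpleGraph V) (hconn : X.Connected)
    (hbip : ¬ X.IsBipartite) (x₀ : X.neighborhoodComplex.Realization)
    (htors : IsMulTorsion (FundamentalGroup X.neighborhoodComplex.Realization x₀)) :
    4 ≤ X.chromaticNumber := by
  by_contra hlt
  have hle : X.chromaticNumber ≤ (3 : ℕ) := Order.le_of_lt_add_one (by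
    rw [not_le] at hlt
    exact_mod_cast hlt)
  obtain ⟨c⟩ := SimpleGraph.chromaticNumber_le_iff_colorable.1 hle
  obtain ⟨g, hg⟩ := c.exists_not_isOfFinOrder hconn hbip x₀
  exact hg (htors g)
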